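/- Let $S$ be a set of sorts, let $T$ be a finitary monad on the category $\mathbf{Set}^S$ of $S$-sorted sets, let $\mathcal C$ be the variety of Eilenberg--Moore algebras of $T$, and let $F\colon\mathcal C\to\mathcal C$ be an endofunctor preserving sifted colimits. An object of $\mathcal C$ is *ffg* (free finitely generated) if it is isomorphic to the free algebra $TX_0$ on an $S$-sorted set $X_0$ with $\coprod_{s\in S}(X_0)_s$ finite. An *ffg-coalgebra* is an $F$-coalgebra $c\colon C\to FC$ with $C$ ffg, and $\varphi F$ is the colimit of all ffg-coalgebras in the category of $F$-coalgebras, with colimit injections $\mathsf{in}\,c\colon C\to\varphi F$. An *ffg-equation* in $A$ is a morphism $e\colon X\to FX+A$ with $X$ ffg. For an $F$-algebra $a\colon FA\to A$, a *solution* of $e$ in $A$ is a morphism $s\colon X\to A$ with $s=[a,\mathrm{id}_A]\cdot(Fs+A)\cdot e$. For $e\colon X\to FX+Y$, $h\colon Y\to Z$ and $f\colon Y\to FY+Z$ put $$h\bullet e=(FX+h)\cdot e,\qquad e\mathbin{\square} f=(\mathsf{can}+Z)\cdot(FX+f)\cdot[e,\mathsf{inr}]\colon X+Y\to F(X+Y)+Z,$$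 where $\mathsf{can}=[F\mathsf{inl},F\mathsf{inr}]\colon FX+FY\to F(X+Y)$. For an ffg object $X$, a morphism $w\colon X\to FX+C$ and an ffg-coalgebra $c\colon C\to FC$ (regarded as an equation with initial parameter object), $w\mathbin{\square} c=\mathsf{can}\cdot(FX+c)\cdot[w,\mathsf{inr}]\colon X+C\to F(X+C)$ is again an ffg-coalgebra. An *ffg-Elgot algebra* is a triple $(A,a,\dagger)$ where $a\colon FA\to A$ is an $F$-algebra and $\dagger$ assigns to every ffg-equation $e\colon X\to FX+A$ in $A$ a solution $e^\dagger\colon X\to A$ such that the following hold. 1. *Weak Functoriality*: for all ffg objects $X,Y,Z$, all $e\colon X\to FX+Z$ and $f\colon Y\to FY+Z$, every $m\colon X\to Y$ with $(Fm+Z)\cdot e=f\cdot m$ and every $h\colon Z\to A$, one has $(h\bullet f)^\dagger\cdot m=(h\bullet e)^\dagger$. 2. *Compositionality*: for all ffg objects $X,Y$ and all $e\colon X\to FX+Y$ and $f\colon Y\to FY+A$, one has $(f^\dagger\bullet e)^\dagger=(e\mathbin{\square} f)^\dagger\cdot\mathsf{inl}$. **Proposition.** The coalgebra structure of $\varphi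 F$ is invertible; let $t\colon F(\varphi F)\to\varphi F$ be its inverse. Every ffg-equation $e\colon X\to FX+\varphi F$ factorizes as $e=(FX+\mathsf{in}\,c)\cdot w$ for some ffg-coalgebra $c\colon C\to FC$ and some $w\colon X\to FX+C$; the morphism $$e^\dagger=\mathsf{in}(w\mathbin{\square} c)\cdot\mathsf{inl}\colon X\to X+C\to\varphi F$$ does not depend on the choice of the factorization; and $(\varphi F,t,\dagger)$ is an ffg-Elgot algebra. -/

import Mathlib

open CategoryTheory Limits

universe u

-- Makes `X ⟶ Y` elaborate through `CategoryStruct`, as the lemmas of the library expect.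
attribute [instance 2000] CategoryTheory.CategoryStruct.toQuiver

/-!
A variety is the category `T.Algebra` of Eilenberg-Moore algebras of a finitary monad `T` on the
category `S → Type u` of `S`-sorted sets. The first section shows that it is cocomplete, so that
coproducts of objects and colimits of coalgebras can be formed.
-/

namespace FFG

section Variety
variable {S : Type u} (T : CategoryTheory.Monad (S → Type u))

instance hasLimits_sorted : HasLimits (S → Type u) :=
  ⟨fun _ _ => ⟨fun _ => pi.hasLimit_of_hasLimit_comp_eval⟩⟩

instance hasColimits_sorted : HasColimits (S → Type u) :=
  ⟨fun _ _ => ⟨fun _ => pi.hasColimit_of_hasColimit_comp_eval⟩⟩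

instance hasLimits_algebra : HasLimits T.Algebra :=
  ⟨fun _ _ => ⟨fun D => Monad.hasLimit_of_comp_forget_hasLimit D⟩⟩

/-- The algebra structures on quotients of the carrier of a free algebra. -/
structure QuotAlg (X : S → Type u) : Type u where
  r : ∀ s, Setoid (T.obj X s)
  a : T.obj (fun s => Quotient (r s)) ⟶ fun s => Quotient (r s)
  unit : T.η.app _ ≫ a = 𝟙 _
  assoc : T.μ.app _ ≫ a = T.map a ≫ a

/-- The algebra underlying an algebra structure on a quotient. -/
def QuotAlg.alg {T : CategoryTheory.Monad (S → Type u)} {X : S → Type u} (Q : QuotAlg T X) : T.Algebra :=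
  ⟨_, Q.a, Q.unit, Q.assoc⟩

/-- Every morphism out of a free algebra factors through its image. -/
theorem exists_algebra_image (X : S → Type u) (A : T.Algebra) (h : T.obj X ⟶ A.A)
    (hh : T.map h ≫ A.a = T.μ.app X ≫ h) :
    ∃ (Q : QuotAlg T X) (e : T.obj X ⟶ Q.alg.A) (m : Q.alg ⟶ A), e ≫ m.f = h ∧ Mono m.f := by
  let hf : ∀ s, T.obj X s → A.A s := fun s => (h s : T.obj X s → A.A s)
  let r : ∀ s, Setoid (T.obj X s) := fun s => Setoid.ker (hf s)
  let Q : S → Type u := fun s => Quotient (r s)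
  let e : T.obj X ⟶ Q := fun s => TypeCat.ofHom (fun x => (Quotient.mk (r s) x : Q s))
  let m : Q ⟶ A.A := fun s => TypeCat.ofHom
    (fun x : Q s => Quotient.lift (hf s) (fun _ _ hab => hab) x)
  let c : Q ⟶ T.obj X := fun s => TypeCat.ofHom (fun x : Q s => Quotient.out x)
  have hem : e ≫ m = h := by
    funext s; ext x; rfl
  have hce : c ≫ e = 𝟙 Q := by
    funext s; ext x
    exact Quotient.out_eq x
  have hcm : c ≫ h = m := by rw [← hem, ← Category.assoc, hce, Category.id_comp]
  have hm : Mono m := by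
    refine ⟨fun {Z} g g' hg => ?_⟩
    funext s; ext z
    have := congrArg (fun k : Z ⟶ A.A => (k s : Z s → A.A s) z) hg
    have inj : Function.Injective
        (fun x : Q s => Quotient.lift (hf s) (fun _ _ hab => hab) x) := by
      intro x y hxy
      induction x using Quotient.ind
      induction y using Quotient.ind
      exact Quotient.sound hxy
    exact inj this
  let a : T.obj Q ⟶ Q := T.map c ≫ T.μ.app X ≫ e
  have ham : a ≫ m = T.map m ≫ A.a := by
    simp only [a, Category.assoc, hem]
    rw [← hh, ← hcm, Functor.map_comp, Category.assoc]
  refine ⟨⟨r, a, ?_, ?_⟩, e, ⟨m, ham.symm⟩, hem, hm⟩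
  · rw [← cancel_mono m, Category.assoc, ham]
    rw [← Category.assoc, ← T.η.naturality]
    simp [A.unit]
  · rw [← cancel_mono m, Category.assoc, ham, Category.assoc, ham]
    simp only [← Category.assoc]
    rw [← T.μ.naturality, ← Functor.map_comp, ham]
    simp [A.assoc]

/-- There is a small weakly initial family of cocones on every small diagram of algebras. -/
theorem solutionSet_const (J : Type u) [SmallCategory J] :
    SolutionSetCondition.{u} (Functor.const J : T.Algebra ⥤ (J ⥤ T.Algebra)) := by
  intro D
  let X : S → Type u := fun s => Σ j, (D.obj j).A s
  refine ⟨Σ Q : QuotAlg T X, D ⟶ (Functor.const J).obj Q.alg, fun i => i.1.alg,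
    fun i => i.2, ?_⟩
  intro A k
  let f : X ⟶ A.A := fun s => TypeCat.ofHom (fun x : X s => ((k.app x.1).f s : _ → A.A s) x.2)
  let h : T.free.obj X ⟶ A := (T.adj.homEquiv X A).symm f
  have hh : T.η.app X ≫ h.f = f := (T.adj.homEquiv X A).apply_symm_apply f
  obtain ⟨Q, e, m, hem, hm⟩ := exists_algebra_image T X A h.f h.h
  let i : ∀ j, (D.obj j).A ⟶ X := fun j s => TypeCat.ofHom (fun x => (⟨j, x⟩ : X s))
  have hif : ∀ j, i j ≫ f = (k.app j).f := fun j => rfl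
  clear_value i h f
  have hi : ∀ j, (i j ≫ T.η.app X ≫ e) ≫ m.f = (k.app j).f := by
    intro j
    simp only [Category.assoc, hem, hh]
    exact hif j
  have hmm : Mono m := (T.forget).mono_of_mono_map hm
  have hl : ∀ j, ∃ l : D.obj j ⟶ Q.alg, l ≫ m = k.app j := fun j =>
    ⟨⟨i j ≫ T.η.app X ≫ e, by
      rw [← cancel_mono m.f, Category.assoc, Category.assoc, hi, ← m.h,
        ← Category.assoc, ← Functor.map_comp, hi]
      exact (k.app j).h⟩, Monad.Algebra.Hom.ext (hi j)⟩
  choose l hl using hl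
  refine ⟨⟨Q, ⟨l, fun j j' g => ?_⟩⟩, m, ?_⟩
  · rw [← cancel_mono m]
    have := k.naturality g
    dsimp at this ⊢
    rw [Category.assoc, Category.comp_id, hl j', hl j, this, Category.comp_id]
  · ext j : 2
    exact hl j

instance hasColimits_algebra : HasColimits T.Algebra :=
  ⟨fun J _ => hasColimitsOfShape_iff_isRightAdjoint_const.2
    (isRightAdjoint_of_preservesLimits_of_solutionSetCondition _ (solutionSet_const T J))⟩

/-- An object is *free finitely generated* (ffg) if it is (isomorphic to) the free algebra on a
finite `S`-sorted set, i.e. one whose total set of elements is finite. -/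
def IsFFG : ObjectProperty T.Algebra := fun X =>
  ∃ X₀ : S → Type u, Finite (Σ s, X₀ s) ∧ Nonempty (X ≅ T.free.obj X₀)

/-- Binary coproducts of ffg objects are ffg. -/
theorem isFFG_coprod {X Y : T.Algebra} (hX : IsFFG T X) (hY : IsFFG T Y) : IsFFG T (X ⨿ Y) := by
  obtain ⟨X₀, hX₀, ⟨eX⟩⟩ := hX
  obtain ⟨Y₀, hY₀, ⟨eY⟩⟩ := hY
  let c : BinaryCofan X₀ Y₀ := BinaryCofan.mk (P := fun s => X₀ s ⊕ Y₀ s)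
    (fun s => TypeCat.ofHom Sum.inl) (fun s => TypeCat.ofHom Sum.inr)
  have hc : IsColimit c := BinaryCofan.IsColimit.mk c
    (fun f g s => TypeCat.ofHom (Sum.elim (f s) (g s)))
    (fun _ _ => rfl) (fun _ _ => rfl)
    (fun {Z} f g m h₁ h₂ => by
      funext s; ext x
      cases x with
      | inl x => exact congrArg (fun k : X₀ ⟶ Z => k s x) h₁
      | inr x => exact congrArg (fun k : Y₀ ⟶ Z => k s x) h₂)
  have : T.free.IsLeftAdjoint := T.adj.isLeftAdjoint
  refine ⟨fun s => X₀ s ⊕ Y₀ s, ?_, ⟨?_⟩⟩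
  · exact Finite.of_equiv _ (Equiv.sigmaSumDistrib X₀ Y₀).symm
  · exact coprod.mapIso eX eY ≪≫ PreservesColimitPair.iso T.free X₀ Y₀ ≪≫
      T.free.mapIso ((colimit.isColimit _).coconePointUniqueUpToIso hc)

end Variety

section Coalg
universe v w w₁ w₂
variable {C : Type w} [Category.{v} C] {F : C ⥤ C}

/-- Colimits of coalgebras are formed in the base category. -/
theorem hasColimit_coalgebra {J : Type w₁} [Category.{w₂} J] (D : J ⥤ Endofunctor.Coalgebra F)
    [HasColimit (D ⋙ Endofunctor.Coalgebra.forget F)] : HasColimit D := by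
  let G := D ⋙ Endofunctor.Coalgebra.forget F
  let inj : ∀ j, (D.obj j).V ⟶ colimit G := fun j => colimit.ι G j
  have hw : ∀ {i j} (f : i ⟶ j), (D.map f).f ≫ inj j = inj i := fun f => colimit.w G f
  have hext : ∀ {Z : C} {f g : colimit G ⟶ Z}, (∀ j, inj j ≫ f = inj j ≫ g) → f = g :=
    fun h => colimit.hom_ext h
  let s : Cocone G := ⟨F.obj (colimit G),
    { app := fun j => (D.obj j).str ≫ F.map (inj j)
      naturality := fun i j f => by
        have h : (D.map f).f ≫ (D.obj j).str ≫ F.map (inj j) = (D.obj i).str ≫ F.map (inj i) := by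
          rw [← Category.assoc, ← (D.map f).h, Category.assoc, ← F.map_comp, hw]
        exact h.trans (Category.comp_id _).symm }⟩
  have hs : ∀ j, inj j ≫ colimit.desc G s = (D.obj j).str ≫ F.map (inj j) :=
    fun j => colimit.ι_desc s j
  let c : Cocone D := ⟨⟨colimit G, colimit.desc G s⟩,
    { app := fun j => ⟨inj j, (hs j).symm⟩
      naturality := fun i j f => by
        ext
        exact (hw f).trans (Category.comp_id _).symm }⟩
  let d : ∀ t : Cocone D, colimit G ⟶ t.pt.V := fun t =>
    colimit.desc G ((Endofunctor.Coalgebra.forget F).mapCocone t)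
  have hd : ∀ t j, inj j ≫ d t = (t.ι.app j).f := fun t j =>
    colimit.ι_desc ((Endofunctor.Coalgebra.forget F).mapCocone t) j
  refine ⟨⟨⟨c, ⟨fun t => ⟨d t, hext fun j => ?_⟩, ?_, ?_⟩⟩⟩⟩
  · change inj j ≫ colimit.desc G s ≫ F.map (d t) = _
    rw [← Category.assoc, hs, Category.assoc, ← F.map_comp, hd, ← Category.assoc, hd]
    exact (t.ι.app j).h
  · intro t j
    ext
    exact hd t j
  · intro t m h
    refine Endofunctor.Coalgebra.Hom.ext (hext fun j => ?_)
    change _ = inj j ≫ d t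
    rw [hd, ← h j]
    rfl

end Coalg

section FFGCoalg
variable {S : Type u} {T : CategoryTheory.Monad (S → Type u)} (F : T.Algebra ⥤ T.Algebra)

/-- The category of ffg-coalgebras: the full subcategory of the category of all `F`-coalgebras
given by those with an ffg carrier. -/
abbrev FFGCoalgebra : Type (u + 1) :=
  ObjectProperty.FullSubcategory (fun c : Endofunctor.Coalgebra F => IsFFG T c.V)

/-- The inclusion of the ffg-coalgebras into all `F`-coalgebras. -/
abbrev ffgInclusion : FFGCoalgebra F ⥤ Endofunctor.Coalgebra F :=
  ObjectProperty.ι (fun c : Endofunctor.Coalgebra F => IsFFG T c.V)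

/-- A finite `S`-sorted set is given, up to isomorphism, by a finite list of sorts. -/
theorem exists_finite_model (X₀ : S → Type u) [Finite (Σ s, X₀ s)] :
    ∃ (n : ℕ) (σ : Fin n → S), Nonempty (X₀ ≅ fun s => ULift.{u} { i : Fin n // σ i = s }) := by
  obtain ⟨n, ⟨e⟩⟩ := Finite.exists_equiv_fin (Σ s, X₀ s)
  refine ⟨n, fun i => (e.symm i).1, ⟨?_⟩⟩
  refine Pi.isoMk fun s => Equiv.toIso ?_
  refine Equiv.trans ?_ Equiv.ulift.symm
  refine Equiv.trans ?_ (Equiv.subtypeEquiv e (p := fun x : Σ s, X₀ s => x.1 = s) ?_)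
  · exact (Equiv.sigmaSubtype s).symm
  · intro x; simp

instance essentiallySmall_ffgCoalgebra : EssentiallySmall.{u} (FFGCoalgebra F) := by
  let A : (Σ n : ℕ, (Fin n → S)) → T.Algebra := fun p =>
    T.free.obj (fun s => ULift.{u} { i : Fin p.1 // p.2 i = s })
  have hA : ∀ p, IsFFG T (A p) := fun p => ⟨_, by
    have : Finite (Σ s, { i : Fin p.1 // p.2 i = s }) :=
      Finite.of_equiv _ (Equiv.sigmaFiberEquiv p.2).symm
    exact Finite.of_equiv _ (Equiv.sigmaCongrRight fun s => Equiv.ulift.symm), ⟨Iso.refl _⟩⟩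
  let K : Type u := Σ p : (Σ n : ℕ, (Fin n → S)), (A p ⟶ F.obj (A p))
  let f : K → Skeleton (FFGCoalgebra F) := fun k => toSkeleton ⟨⟨A k.1, k.2⟩, hA k.1⟩
  rw [essentiallySmall_iff]
  refine ⟨small_of_surjective (f := f) ?_, inferInstance⟩
  intro q
  obtain ⟨c, rfl⟩ := Quotient.exists_rep q
  obtain ⟨X₀, hX₀, ⟨e⟩⟩ := c.property
  obtain ⟨n, σ, ⟨e'⟩⟩ := exists_finite_model X₀
  let e'' : c.obj.V ≅ A ⟨n, σ⟩ := e ≪≫ T.free.mapIso e'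
  refine ⟨⟨⟨n, σ⟩, e''.inv ≫ c.obj.str ≫ F.map e''.hom⟩, Quotient.sound ⟨?_⟩⟩
  refine Iso.symm (ObjectProperty.isoMk _ (Endofunctor.Coalgebra.isoMk e'' ?_))
  simp

instance hasColimit_ffgInclusion : HasColimit (ffgInclusion F) := by
  have : HasColimitsOfShape (FFGCoalgebra F) T.Algebra :=
    hasColimitsOfShape_of_equivalence (equivSmallModel.{u} (FFGCoalgebra F)).symm
  exact hasColimit_coalgebra _

/-- The coalgebra `φF`: the colimit, in the category of `F`-coalgebras, of all ffg-coalgebras. -/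
noncomputable def phi : Endofunctor.Coalgebra F := colimit (ffgInclusion F)

/-- The colimit injection `in c : C ⟶ φF` of an ffg-coalgebra `c : C ⟶ FC`. -/
noncomputable def phiIn (c : FFGCoalgebra F) : c.obj.V ⟶ (phi F).V :=
  (colimit.ι (ffgInclusion F) c).f

/-- `F` preserves sifted colimits. -/
def PreservesSiftedColimits : Prop :=
  ∀ (J : Type u) [SmallCategory J] [IsSifted J], PreservesColimitsOfShape J F

end FFGCoalg

section Equations
variable {S : Type u} {T : CategoryTheory.Monad (S → Type u)} {F : T.Algebra ⥤ T.Algebra}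

/-- For `e : X ⟶ FX + A` and `h : A ⟶ B`, the equation
`h • e = (X ⟶ FX + A ⟶ FX + B)`. -/
noncomputable def bullet {X A B : T.Algebra} (h : A ⟶ B) (e : X ⟶ F.obj X ⨿ A) :
    X ⟶ F.obj X ⨿ B :=
  e ≫ coprod.map (𝟙 (F.obj X)) h

/-- For `e : X ⟶ FX + Y` and `f : Y ⟶ FY + Z`, the equation
`e □ f = (X + Y ⟶ FX + Y ⟶ FX + FY + Z ⟶ F(X + Y) + Z)` given by `[e, inr]`, `FX + f` and
`can + Z`, where `can = [F inl, F inr]`. -/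
noncomputable def square {X Y Z : T.Algebra} (e : X ⟶ F.obj X ⨿ Y) (f : Y ⟶ F.obj Y ⨿ Z) :
    X ⨿ Y ⟶ F.obj (X ⨿ Y) ⨿ Z :=
  coprod.desc e coprod.inr ≫ coprod.map (𝟙 (F.obj X)) f ≫
    (coprod.associator (F.obj X) (F.obj Y) Z).inv ≫
    coprod.map (coprod.desc (F.map coprod.inl) (F.map coprod.inr)) (𝟙 Z)

/-- For `w : X ⟶ FX + C` with `X` ffg and an ffg-coalgebra `c : C ⟶ FC`, regarded as an equation
without parameters, the ffg-coalgebra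
`w □ c = (X + C ⟶ FX + C ⟶ FX + FC ⟶ F(X + C))` given by `[w, inr]`, `FX + c` and `can`. -/
noncomputable def squareCoalgebra {X : T.Algebra} (hX : IsFFG T X) (c : FFGCoalgebra F)
    (w : X ⟶ F.obj X ⨿ c.obj.V) : FFGCoalgebra F where
  obj :=
    { V := X ⨿ c.obj.V
      str := coprod.desc w coprod.inr ≫ coprod.map (𝟙 (F.obj X)) c.obj.str ≫
        coprod.desc (F.map coprod.inl) (F.map coprod.inr) }
  property := isFFG_coprod T hX c.property

/-- `s` is a solution of `e` in the algebra `a`: `s = [a, A] ∘ (Fs + A) ∘ e`. -/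
def IsSolution (a : Endofunctor.Algebra F) {X : T.Algebra} (e : X ⟶ F.obj X ⨿ a.a)
    (s : X ⟶ a.a) : Prop :=
  s = e ≫ coprod.map (F.map s) (𝟙 a.a) ≫ coprod.desc a.str (𝟙 a.a)

variable (F) in
/-- An operation `†` assigning to every ffg-equation `e : X ⟶ FX + A` in `A` a morphism `X ⟶ A`. -/
def SolutionOperator (A : T.Algebra) : Type (u + 1) :=
  ∀ X : T.Algebra, IsFFG T X → (X ⟶ F.obj X ⨿ A) → (X ⟶ A)

/-- `(A, a, †)` is an ffg-Elgot algebra. -/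
structure IsFFGElgotAlgebra (a : Endofunctor.Algebra F) (dag : SolutionOperator F a.a) : Prop where
  solution : ∀ (X : T.Algebra) (hX : IsFFG T X) (e : X ⟶ F.obj X ⨿ a.a),
    IsSolution a e (dag X hX e)
  weakFunctoriality : ∀ (X Y Z : T.Algebra) (hX : IsFFG T X) (hY : IsFFG T Y) (_ : IsFFG T Z)
    (e : X ⟶ F.obj X ⨿ Z) (f : Y ⟶ F.obj Y ⨿ Z) (m : X ⟶ Y),
    e ≫ coprod.map (F.map m) (𝟙 Z) = m ≫ f →
    ∀ h : Z ⟶ a.a, m ≫ dag Y hY (bullet h f) = dag X hX (bullet h e)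
  compositionality : ∀ (X Y : T.Algebra) (hX : IsFFG T X) (hY : IsFFG T Y)
    (e : X ⟶ F.obj X ⨿ Y) (f : Y ⟶ F.obj Y ⨿ a.a),
    dag X hX (bullet (dag Y hY f) e) =
      coprod.inl ≫ dag (X ⨿ Y) (isFFG_coprod T hX hY) (square e f)

end Equations

end FFG

/-! The category of ffg-coalgebras is nonempty, has binary coproducts and is essentially small, so
it is sifted. A hom-functor out of an ffg object commutes with colimits over such a category:
morphisms out of a finite sorted set are finite families of elements, these commute with such
colimits, and a finitary monad preserves them, so the forgetful functor does too.

Let `G` be the identity, `F` or `FX + (-)`. Each preserves the colimit defining `φF`: `F` by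
hypothesis, `FX + (-)` because the index category is connected. So for `X` ffg, the set of morphisms
`X ⟶ G(φF)` is the colimit of the sets of morphisms `X ⟶ GC`. Hence every such morphism factors
through some `G(in c)` (`exists_factorization`), and whatever is assigned to the factorizations
invariantly under coalgebra homomorphisms depends only on the composite (`factorization_respects`).

For `G = F` this inverts the structure of `φF`: a morphism `f : X ⟶ FC` makes `X + C` a coalgebra,
and `X ⟶ X + C ⟶ φF` is the preimage of `F(in c) ∘ f`. For `G = FX + (-)` it yields the
factorization of equations and the independence of `†`.

The axioms come from coalgebra homomorphisms. The solution property is that `in(w □ c)` is one. Weak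
functoriality holds because `m + C` is one, once the parameter map `Z ⟶ φF` has been factored
through some `in c`. Compositionality holds because the associator is one, from `(e □ w) □ c` to
`(inl • e) □ (w □ c)`. -/

namespace FFG

/-! ### Finite families of elements and colimits over categories with binary coproducts. -/

section SortedColimits
universe v w

variable {J : Type w} [Category.{v} J]

/-- A cocone of types is colimiting when it is jointly surjective and every cocone respects
the equalities that hold in it. -/
noncomputable def isColimitOfRespects {G : J ⥤ Type u} (c : Cocone G)
    (surj : ∀ x : c.pt, ∃ j y, c.ι.app j y = x)
    (inj : ∀ (s : Cocone G) (j k : J) (x : G.obj j) (y : G.obj k),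
      c.ι.app j x = c.ι.app k y → s.ι.app j x = s.ι.app k y) : IsColimit c where
  desc s := TypeCat.ofHom fun x => s.ι.app _ (surj x).choose_spec.choose
  fac s j := by
    ext x
    exact inj s _ _ _ _ (surj (c.ι.app j x)).choose_spec.choose_spec
  uniq s m hm := by
    ext x
    have h := (surj x).choose_spec.choose_spec
    have := ConcreteCategory.congr_hom (hm (surj x).choose) (surj x).choose_spec.choose
    refine Eq.trans ?_ this
    change m x = m (c.ι.app _ _)
    rw [h]

theorem respects_of_isColimit {G : J ⥤ Type u} {c : Cocone G} (hc : IsColimit c) (s : Cocone G)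
    {j k : J} {x : G.obj j} {y : G.obj k} (h : c.ι.app j x = c.ι.app k y) :
    s.ι.app j x = s.ι.app k y := by
  have h₁ := ConcreteCategory.congr_hom (hc.fac s j) x
  have h₂ := ConcreteCategory.congr_hom (hc.fac s k) y
  refine h₁.symm.trans (Eq.trans ?_ h₂)
  change hc.desc s (c.ι.app j x) = hc.desc s (c.ι.app k y)
  rw [h]

variable {S : Type u}

/-- The sortwise colimit cocone of a diagram of sorted sets. -/
noncomputable def sortedCocone [HasColimitsOfShape J (Type u)] (K : J ⥤ (S → Type u)) :
    Cocone K where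
  pt s := colimit (K ⋙ Pi.eval _ s)
  ι :=
    { app := fun j s => colimit.ι (K ⋙ Pi.eval _ s) j
      naturality := fun i j f => by
        funext s
        exact (colimit.cocone (K ⋙ Pi.eval _ s)).ι.naturality f }

/-- A cocone of sorted sets is colimiting when it is so sortwise. -/
noncomputable def isColimitOfSortwise {K : J ⥤ (S → Type u)} (c : Cocone K)
    (h : ∀ s, IsColimit ((Pi.eval _ s).mapCocone c)) : IsColimit c where
  desc t s := (h s).desc ((Pi.eval _ s).mapCocone t)
  fac t j := by
    funext s
    exact (h s).fac ((Pi.eval _ s).mapCocone t) j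
  uniq t m hm := by
    funext s
    exact (h s).uniq ((Pi.eval _ s).mapCocone t) (m s) fun j => congrFun (hm j) s

instance hasColimitsOfShape_sorted [HasColimitsOfShape J (Type u)] :
    HasColimitsOfShape J (S → Type u) :=
  ⟨fun K => ⟨⟨sortedCocone K, isColimitOfSortwise _ fun _ => colimit.isColimit _⟩⟩⟩

instance preservesColimitsOfShape_eval [HasColimitsOfShape J (Type u)] (s : S) :
    PreservesColimitsOfShape J (Pi.eval (fun _ : S => Type u) s) :=
  ⟨fun {K} => preservesColimit_of_preserves_colimit_cocone
    (isColimitOfSortwise (sortedCocone K) fun _ => colimit.isColimit _)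
    (colimit.isColimit (K ⋙ Pi.eval _ s))⟩

variable [HasColimitsOfShape J (Type u)]

/-- The functor of families of elements of the given sorts. -/
def families {I : Type u} (σ : I → S) : (S → Type u) ⥤ Type u where
  obj A := ∀ i, A (σ i)
  map f := TypeCat.ofHom fun x i => f (σ i) (x i)

/-- Finite families of elements commute with colimits over categories with binary coproducts. -/
theorem nonempty_isColimit_families [HasBinaryCoproducts J] [Nonempty J] {K : J ⥤ (S → Type u)}
    {c : Cocone K} (hc : IsColimit c) (I : Type u) [Finite I] : ∀ σ : I → S,
    Nonempty (IsColimit ((families σ).mapCocone c)) := by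
  have : IsConnected J := inferInstance
  induction I using Finite.induction_empty_option with
  | of_equiv e ih =>
    intro σ
    obtain ⟨h⟩ := ih (σ ∘ e)
    let φ : ∀ A : S → Type u, (∀ i, A (σ (e i))) ≃ ∀ i, A (σ i) :=
      fun A => e.piCongrLeft fun i => A (σ i)
    have hφ : ∀ {A B : S → Type u} (f : A ⟶ B) (x : ∀ i, A (σ (e i))),
        (families σ).map f (φ A x) = φ B ((families (σ ∘ e)).map f x) := by
      intro A B f x
      funext i
      obtain ⟨i, rfl⟩ := e.surjective i
      change f _ (φ A x (e i)) = φ B (fun i => f (σ (e i)) (x i)) (e i)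
      simp only [φ, Equiv.piCongrLeft_apply_apply]
    refine ⟨isColimitOfRespects _ (fun x => ?_) fun s j k x y hxy => ?_⟩
    · obtain ⟨j, y, hy⟩ := Types.jointly_surjective_of_isColimit h ((φ _).symm x)
      refine ⟨j, φ _ y, (hφ _ _).trans ?_⟩
      exact (congrArg (φ _) hy).trans (Equiv.apply_symm_apply _ _)
    · let s' : Cocone (K ⋙ families (σ ∘ e)) :=
        { pt := s.pt
          ι :=
            { app := fun j => TypeCat.ofHom fun x => s.ι.app j (φ _ x)
              naturality := fun i j f => by
                ext x
                refine Eq.trans ?_ (ConcreteCategory.congr_hom (s.ι.naturality f) (φ _ x))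
                exact (congrArg (s.ι.app j) (hφ (K.map f) x)).symm } }
      obtain ⟨x, rfl⟩ := (φ _).surjective x
      obtain ⟨y, rfl⟩ := (φ _).surjective y
      refine respects_of_isColimit h s' ((φ c.pt).injective ?_)
      exact ((hφ _ _).symm.trans hxy).trans (hφ _ _)
  | h_empty =>
    intro σ
    refine ⟨isColimitOfRespects _ (fun x => ?_) fun s j k x y _ => ?_⟩
    · exact ⟨Classical.arbitrary J, fun i => i.elim, funext fun i => i.elim⟩
    -- Every stage has exactly one empty family, so the claim is that the legs agree on it;
    -- connectedness of `J` gives this.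
    · have := constant_of_preserves_morphisms (J := J)
        (fun j => s.ι.app j (fun i => i.elim : ∀ i : PEmpty.{u + 1}, K.obj j (σ i)))
        (fun i j f => by
          have := ConcreteCategory.congr_hom (s.ι.naturality f) (fun i => i.elim)
          refine this.symm.trans (congrArg (s.ι.app j) (funext fun i => i.elim))) j k
      refine Eq.trans (congrArg (s.ι.app j) (funext fun i => i.elim)) (this.trans ?_)
      exact congrArg (s.ι.app k) (funext fun i => i.elim)
  | @h_option I _ ih =>
    intro σ
    obtain ⟨h⟩ := ih (σ ∘ some)
    have h₀ : IsColimit ((Pi.eval (fun _ : S => Type u) (σ none)).mapCocone c) :=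
      isColimitOfPreserves _ hc
    let cons : ∀ A : S → Type u, A (σ none) → (∀ i, A (σ (some i))) → ∀ i, A (σ i) :=
      fun A a x i => Option.rec a x i
    have hcons : ∀ {A B : S → Type u} (f : A ⟶ B) a x,
        (families σ).map f (cons A a x) =
          cons B (f _ a) ((families (σ ∘ some)).map f x) := by
      intro A B f a x
      funext i
      cases i <;> rfl
    have hcons' : ∀ A (x : ∀ i, A (σ i)), cons A (x none) (fun i => x (some i)) = x := by
      intro A x
      funext i
      cases i <;> rfl
    have hcomp : ∀ {i j k : J} {f : i ⟶ j} {g : j ⟶ k} {h : i ⟶ k} (_ : f ≫ g = h) (s : S)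
        (x : K.obj i s), K.map g s (K.map f s x) = K.map h s x := by
      rintro i j k f g h rfl s x
      rw [K.map_comp]
      rfl
    have hid : ∀ {i j : J} {f : i ⟶ j} {g : j ⟶ i} (_ : f ≫ g = 𝟙 i) (s : S)
        (x : K.obj i s), K.map g s (K.map f s x) = x := by
      intro i j f g h s x
      rw [hcomp h, K.map_id]
      rfl
    have hw : ∀ (s : Cocone (K ⋙ families σ)) {j k : J} (f : j ⟶ k) x,
        s.ι.app k ((families σ).map (K.map f) x) = s.ι.app j x := fun s j k f x =>
      ConcreteCategory.congr_hom (s.w f) x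
    have hcw : ∀ {j k : J} (f : j ⟶ k) (t : S) (x : K.obj j t),
        c.ι.app k t (K.map f t x) = c.ι.app j t x := fun f t x =>
      ConcreteCategory.congr_hom (congrFun (c.w f) t) x
    refine ⟨isColimitOfRespects _ (fun x => ?_) fun s j k x y hxy => ?_⟩
    · obtain ⟨j, a, ha⟩ := Types.jointly_surjective_of_isColimit h₀ (x none)
      obtain ⟨k, y, hy⟩ := Types.jointly_surjective_of_isColimit h (fun i => x (some i))
      refine ⟨j ⨿ k, cons _ (K.map coprod.inl _ a) ((families _).map (K.map coprod.inr) y), ?_⟩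
      refine (hcons _ _ _).trans (Eq.trans ?_ (hcons' _ x))
      congr 1
      · exact (hcw (coprod.inl : j ⟶ j ⨿ k) _ _).trans ha
      · refine Eq.trans ?_ hy
        funext i
        exact hcw (coprod.inr : k ⟶ j ⨿ k) _ _
    -- `ψ` evaluates the cocone `s` on a head and a tail taken from different stages, after moving
    -- both to `j ⨿ k`. It is natural in each stage separately, and on the diagonal the codiagonal
    -- `j ⨿ j ⟶ j` gives back `s`.
    · let ψ : ∀ j k, K.obj j (σ none) → (∀ i, K.obj k (σ (some i))) → s.pt := fun j k a x =>
        s.ι.app (j ⨿ k) (cons _ (K.map coprod.inl _ a) ((families _).map (K.map coprod.inr) x))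
      have hψ : ∀ j x, s.ι.app j x = ψ j j (x none) (fun i => x (some i)) := by
        intro j x
        refine Eq.trans ?_ (hw s (coprod.desc (𝟙 j) (𝟙 j)) _)
        refine congrArg (s.ι.app j) (Eq.trans ?_ (hcons _ _ _).symm)
        refine (hcons' _ x).symm.trans ?_
        congr 1
        · exact (hid (coprod.inl_desc _ _) _ _).symm
        · funext i
          exact (hid (coprod.inr_desc _ _) _ _).symm
      have hψ₁ : ∀ {i j : J} (f : i ⟶ j) k a x,
          ψ j k (K.map f _ a) x = ψ i k a x := by
        intro i j f k a x
        refine Eq.trans ?_ (hw s (coprod.map f (𝟙 k)) _)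
        refine congrArg (s.ι.app _) (Eq.trans ?_ (hcons _ _ _).symm)
        congr 1
        · exact (hcomp rfl _ _).trans (hcomp (coprod.inl_map _ _) _ _).symm
        · funext i
          exact (hcomp ((coprod.inr_map f (𝟙 k)).trans (Category.id_comp _)) _ _).symm
      have hψ₂ : ∀ {i j : J} (f : i ⟶ j) k a x,
          ψ k j a ((families (σ ∘ some)).map (K.map f) x) = ψ k i a x := by
        intro i j f k a x
        refine Eq.trans ?_ (hw s (coprod.map (𝟙 k) f) _)
        refine congrArg (s.ι.app _) (Eq.trans ?_ (hcons _ _ _).symm)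
        congr 1
        · exact (hcomp ((coprod.inl_map (𝟙 k) f).trans (Category.id_comp _)) _ _).symm
        · funext i
          exact (hcomp rfl _ _).trans (hcomp (coprod.inr_map _ _) _ _).symm
      let t₁ : ∀ k, (∀ i, K.obj k (σ (some i))) → Cocone (K ⋙ Pi.eval _ (σ none)) := fun k x =>
        { pt := s.pt
          ι :=
            { app := fun j => TypeCat.ofHom fun a => ψ j k a x
              naturality := fun i j f => by
                ext a
                exact hψ₁ f k a x } }
      let t₂ : ∀ k, K.obj k (σ none) → Cocone (K ⋙ families (σ ∘ some)) := fun k a =>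
        { pt := s.pt
          ι :=
            { app := fun j => TypeCat.ofHom fun x => ψ k j a x
              naturality := fun i j f => by
                ext x
                exact hψ₂ f k a x } }
      -- The head and the tail are now exchanged one at a time, each by its own colimit.
      rw [hψ, hψ]
      refine (respects_of_isColimit h₀ (t₁ j fun i => x (some i)) (j := j) (k := k)
        (x := x none) (y := y none) (congrFun hxy none)).trans ?_
      exact respects_of_isColimit h (t₂ k (y none)) (j := j) (k := k)
        (x := fun i => x (some i)) (y := fun i => y (some i))
        (funext fun i => congrFun hxy (some i))

/-- Morphisms out of a finite sorted set commute with colimits over categories with binary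
coproducts. -/
theorem preservesColimitsOfShape_coyoneda_finite [HasBinaryCoproducts J] [Nonempty J]
    (X : S → Type u) [Finite (Σ s, X s)] :
    PreservesColimitsOfShape J (coyoneda.obj (Opposite.op X)) := by
  have : PreservesColimitsOfShape J (families (fun x : Σ s, X s => x.1)) :=
    ⟨⟨fun hc => nonempty_isColimit_families hc _ _⟩⟩
  refine preservesColimitsOfShape_of_natIso
    (F := families (fun x : Σ s, X s => x.1)) (NatIso.ofComponents (fun A => ?_) ?_)
  · exact Equiv.toIso
      { toFun := fun x => show X ⟶ A from fun s => TypeCat.ofHom fun y => x ⟨s, y⟩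
        invFun := fun f x => (f : X ⟶ A) x.1 x.2
        left_inv := fun _ => rfl
        right_inv := fun _ => rfl }
  · intros
    rfl

end SortedColimits
-- Finitary functors preserve these colimits.
section Finitary
variable {S : Type u}

/-- The diagram of the finite sorted subsets of a sorted set. -/
def finiteSubsets (A : S → Type u) : Finset (Σ s, A s) ⥤ (S → Type u) where
  obj B s := { x : A s // (⟨s, x⟩ : Σ s, A s) ∈ B }
  map f s := TypeCat.ofHom fun x => ⟨x.1, leOfHom f x.2⟩

instance finite_finiteSubsets (A : S → Type u) (B : Finset (Σ s, A s)) :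
    Finite (Σ s, (finiteSubsets A).obj B s) := by
  refine Finite.of_injective
    (fun x : (Σ s, { y : A s // (⟨s, y⟩ : Σ s, A s) ∈ B }) => (⟨⟨x.1, x.2.1⟩, x.2.2⟩ : B)) ?_
  rintro ⟨s, x, hx⟩ ⟨t, y, hy⟩ h
  simp only [Subtype.mk.injEq, Sigma.mk.injEq] at h
  obtain ⟨rfl, h⟩ := h
  obtain rfl := eq_of_heq h
  rfl

/-- The inclusion of a finite sorted subset. -/
def finiteSubsetsι (A : S → Type u) (B : Finset (Σ s, A s)) : (finiteSubsets A).obj B ⟶ A :=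
  fun _ => TypeCat.ofHom fun x => x.1

theorem finiteSubsets_map_ι (A : S → Type u) {B B' : Finset (Σ s, A s)} (f : B ⟶ B') :
    (finiteSubsets A).map f ≫ finiteSubsetsι A B' = finiteSubsetsι A B :=
  rfl

/-- A sorted set is the union of its finite subsets. -/
def finiteSubsetsCocone (A : S → Type u) : Cocone (finiteSubsets A) where
  pt := A
  ι := { app := finiteSubsetsι A }

theorem nonempty_isColimit_finiteSubsets (A : S → Type u) :
    Nonempty (IsColimit (finiteSubsetsCocone A)) := by
  classical
  refine ⟨isColimitOfSortwise _ fun s => isColimitOfRespects _ (fun x => ?_) ?_⟩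
  · exact ⟨{⟨s, x⟩}, ⟨x, Finset.mem_singleton_self _⟩, rfl⟩
  · intro t B B' x y hxy
    obtain ⟨x, hx⟩ := x
    obtain ⟨y, hy⟩ := y
    obtain rfl : x = y := hxy
    have h₁ := ConcreteCategory.congr_hom
      (t.w (homOfLE (Finset.subset_union_left : B ⊆ B ∪ B'))) ⟨x, hx⟩
    have h₂ := ConcreteCategory.congr_hom
      (t.w (homOfLE (Finset.subset_union_right : B' ⊆ B ∪ B'))) ⟨x, hy⟩
    exact h₁.symm.trans h₂

variable (T : (S → Type u) ⥤ (S → Type u)) [PreservesFilteredColimits T]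

/-- Finitariness is used here: the poset of finite subsets is filtered. -/
theorem nonempty_isColimit_map_finiteSubsets (A : S → Type u) (s : S) :
    Nonempty (IsColimit ((T ⋙ Pi.eval _ s).mapCocone (finiteSubsetsCocone A))) := by
  classical
  exact ⟨isColimitOfPreserves _ (nonempty_isColimit_finiteSubsets A).some⟩

theorem exists_finite_support (A : S → Type u) (s : S) (x : T.obj A s) :
    ∃ (B : S → Type u) (_ : Finite (Σ s, B s)) (i : B ⟶ A) (y : T.obj B s), T.map i s y = x := by
  obtain ⟨B, y, h⟩ := Types.jointly_surjective_of_isColimit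
    (nonempty_isColimit_map_finiteSubsets T A s).some x
  exact ⟨(finiteSubsets A).obj B, inferInstance, finiteSubsetsι A B, y, h⟩

theorem exists_finite_factorization {A L : S → Type u} [Finite (Σ s, A s)] (p : A ⟶ L) :
    ∃ (R : Finset (Σ s, L s)) (a : A ⟶ (finiteSubsets L).obj R),
      a ≫ finiteSubsetsι L R = p := by
  classical
  have := Fintype.ofFinite (Σ s, A s)
  exact ⟨Finset.univ.image (fun x : Σ s, A s => (⟨x.1, p x.1 x.2⟩ : Σ s, L s)),
    fun s => TypeCat.ofHom fun x =>
      ⟨p s x, Finset.mem_image.2 ⟨⟨s, x⟩, Finset.mem_univ _, rfl⟩⟩, rfl⟩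

/-- An equality in the values of a finitary functor holds at a finite stage. -/
theorem exists_finite_equalizer {A B L : S → Type u} [Finite (Σ s, A s)] [Finite (Σ s, B s)]
    (p : A ⟶ L) (q : B ⟶ L) (s : S) (x : T.obj A s) (y : T.obj B s)
    (h : T.map p s x = T.map q s y) :
    ∃ (R : S → Type u) (_ : Finite (Σ s, R s)) (r : R ⟶ L) (a : A ⟶ R) (b : B ⟶ R),
      a ≫ r = p ∧ b ≫ r = q ∧ T.map a s x = T.map b s y := by
  classical
  obtain ⟨P, a, ha⟩ := exists_finite_factorization p
  obtain ⟨Q, b, hb⟩ := exists_finite_factorization q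
  have hc := (nonempty_isColimit_map_finiteSubsets T L s).some
  obtain ⟨R, f, g, hR⟩ := (Types.FilteredColimit.isColimit_eq_iff _ hc
    (xi := T.map a s x) (xj := T.map b s y)).1 (by
      rw [← ha, ← hb, T.map_comp, T.map_comp] at h
      exact h)
  refine ⟨(finiteSubsets L).obj R, inferInstance, finiteSubsetsι L R,
    a ≫ (finiteSubsets L).map f, b ≫ (finiteSubsets L).map g, ?_, ?_, ?_⟩
  · rw [Category.assoc, finiteSubsets_map_ι, ha]
  · rw [Category.assoc, finiteSubsets_map_ι, hb]
  · rw [T.map_comp, T.map_comp]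
    exact hR

universe v w
variable {J : Type w} [Category.{v} J] [HasColimitsOfShape J (Type u)]
  [HasBinaryCoproducts J] [Nonempty J]

/-- Finitary functors between categories of sorted sets preserve colimits over categories with
binary coproducts. -/
theorem preservesColimitsOfShape_of_finitary : PreservesColimitsOfShape J T := by
  refine ⟨fun {K} => ⟨fun {c} hc => ⟨isColimitOfSortwise _ fun s => isColimitOfRespects _ ?_ ?_⟩⟩⟩
  · intro x
    obtain ⟨B, _, i, y, hy⟩ := exists_finite_support T c.pt s x
    have := preservesColimitsOfShape_coyoneda_finite (J := J) B
    obtain ⟨j, g, hg⟩ := Types.jointly_surjective_of_isColimit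
      (isColimitOfPreserves (coyoneda.obj (Opposite.op B)) hc) i
    replace hg : g ≫ c.ι.app j = i := hg
    refine ⟨j, T.map g s y, ?_⟩
    rw [← hg, T.map_comp] at hy
    exact hy
  · intro t j k x y hxy
    obtain ⟨A, _, i, x, rfl⟩ := exists_finite_support T (K.obj j) s x
    obtain ⟨B, _, i', y, rfl⟩ := exists_finite_support T (K.obj k) s y
    obtain ⟨R, _, r, a, b, ha, hb, hab⟩ :=
      exists_finite_equalizer T (i ≫ c.ι.app j) (i' ≫ c.ι.app k) s x y (by
        rw [T.map_comp, T.map_comp]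
        exact hxy)
    have := preservesColimitsOfShape_coyoneda_finite (J := J) R
    obtain ⟨l, g, hg⟩ := Types.jointly_surjective_of_isColimit
      (isColimitOfPreserves (coyoneda.obj (Opposite.op R)) hc) r
    replace hg : g ≫ c.ι.app l = r := hg
    -- For a fixed element `x` of `T A`, the assignment `f ↦ t (T f x)` is a cocone on the morphisms
    -- from `A` into the diagram. As `A` is finite, its value depends only on the composite of `f`
    -- with the colimit leg.
    have key : ∀ {A : S → Type u} [Finite (Σ s, A s)] {j : J} (i : A ⟶ K.obj j) (a : A ⟶ R)
        (x : T.obj A s) (_ : a ≫ r = i ≫ c.ι.app j),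
        t.ι.app j (T.map i s x) = t.ι.app l (T.map g s (T.map a s x)) := by
      intro A _ j i a x h
      have := preservesColimitsOfShape_coyoneda_finite (J := J) A
      let t' : Cocone (K ⋙ coyoneda.obj (Opposite.op A)) :=
        { pt := t.pt
          ι :=
            { app := fun j => TypeCat.ofHom fun f : A ⟶ K.obj j => t.ι.app j (T.map f s x)
              naturality := fun i j f => by
                ext e
                refine Eq.trans ?_ (ConcreteCategory.congr_hom (t.w f) (T.map e s x))
                change t.ι.app j (T.map (e ≫ K.map f) s x) = _
                rw [T.map_comp]
                rfl } }
      have := respects_of_isColimit (isColimitOfPreserves (coyoneda.obj (Opposite.op A)) hc) t'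
        (j := j) (k := l) (x := i) (y := a ≫ g) (by
          change i ≫ c.ι.app j = (a ≫ g) ≫ c.ι.app l
          rw [Category.assoc, hg, h])
      refine this.trans ?_
      change t.ι.app l (T.map (a ≫ g) s x) = _
      rw [T.map_comp]
      rfl
    rw [key i a x ha, key i' b y hb, hab]

end Finitary

/-! ### Hom-functors of ffg algebras. -/

section Perfect
universe v w
variable {S : Type u} (T : CategoryTheory.Monad (S → Type u))
variable [PreservesFilteredColimits T.toFunctor]
variable (J : Type w) [Category.{v} J] [HasColimitsOfShape J (Type u)]
  [HasBinaryCoproducts J] [Nonempty J]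

/-- The forgetful functor of a monad creates the colimits that the monad preserves. -/
theorem preservesColimitsOfShape_forget : PreservesColimitsOfShape J T.forget := by
  have := preservesColimitsOfShape_of_finitary (J := J) T.toFunctor
  infer_instance

/-- Morphisms out of an ffg object commute with colimits over categories with binary
coproducts. -/
theorem preservesColimitsOfShape_coyoneda {X : T.Algebra} (hX : IsFFG T X) :
    PreservesColimitsOfShape J (coyoneda.obj (Opposite.op X)) := by
  obtain ⟨X₀, _, ⟨e⟩⟩ := hX
  have := preservesColimitsOfShape_forget T J
  have := preservesColimitsOfShape_coyoneda_finite (J := J) X₀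
  refine preservesColimitsOfShape_of_natIso (F := T.forget ⋙ coyoneda.obj (Opposite.op X₀)) ?_
  exact NatIso.ofComponents
    (fun A => ((T.adj.homEquiv X₀ A).symm.trans e.symm.homFromEquiv).toIso) (by
      intro A B f
      ext g
      exact congrArg (e.hom ≫ ·) (T.adj.homEquiv_naturality_right_symm g f))

end Perfect
-- The ffg algebras detect isomorphisms.
section Generators
variable {S : Type u} {T : CategoryTheory.Monad (S → Type u)}

theorem isFFG_free (X : S → Type u) [Finite (Σ s, X s)] : IsFFG T (T.free.obj X) :=
  ⟨X, inferInstance, ⟨Iso.refl _⟩⟩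

/-- A morphism of algebras is invertible when every ffg object sees it as a bijection. -/
theorem isIso_of_bijective_comp {A B : T.Algebra} (f : A ⟶ B)
    (h : ∀ X, IsFFG T X → Function.Bijective fun g : X ⟶ A => g ≫ f) : IsIso f := by
  have h₀ : ∀ (X : S → Type u) [Finite (Σ s, X s)],
      Function.Bijective fun g : X ⟶ A.A => g ≫ f.f := by
    intro X _
    have : (fun g : X ⟶ A.A => g ≫ f.f) = (T.adj.homEquiv X B) ∘
        (fun g : T.free.obj X ⟶ A => g ≫ f) ∘ (T.adj.homEquiv X A).symm := by
      funext g
      refine Eq.symm ((T.adj.homEquiv_naturality_right _ _).trans ?_)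
      exact congrArg (· ≫ f.f) ((T.adj.homEquiv X A).apply_symm_apply g)
    rw [this]
    exact (Equiv.bijective _).comp ((h _ (isFFG_free X)).comp (Equiv.bijective _))
  have h₁ : IsIso (T.forget.map f) := by
    refine (isIso_pi_iff _).2 fun s => (isIso_iff_bijective _).2 ?_
    -- `X` has a single element, of sort `s`, so morphisms out of it are elements of sort `s`; `el`
    -- is this correspondence.
    let X : S → Type u := fun t => ULift (PLift (s = t))
    have : Finite (Σ t, X t) := by
      refine Finite.of_injective (fun _ => ()) ?_
      rintro ⟨t, ⟨⟨rfl⟩⟩⟩ ⟨t', ⟨⟨rfl⟩⟩⟩ _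
      rfl
    let el : ∀ {C : S → Type u}, C s → (X ⟶ C) := fun x t =>
      TypeCat.ofHom fun e => e.down.down ▸ x
    have hel : ∀ {C : S → Type u} (g : X ⟶ C), el (g s ⟨⟨rfl⟩⟩) = g := by
      intro C g
      funext t
      ext ⟨⟨e⟩⟩
      subst e
      rfl
    refine ⟨fun x y hxy => ?_, fun y => ?_⟩
    · have h₂ : el x ≫ f.f = el y ≫ f.f := by
        rw [← hel (el x ≫ f.f), ← hel (el y ≫ f.f)]
        exact congrArg el hxy
      exact congrArg (fun g : X ⟶ A.A => g s ⟨⟨rfl⟩⟩) ((h₀ X).1 h₂)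
    · obtain ⟨g, hg⟩ := (h₀ X).2 (el y)
      exact ⟨g s ⟨⟨rfl⟩⟩, congrArg (fun g : X ⟶ B.A => g s ⟨⟨rfl⟩⟩) hg⟩
  exact isIso_of_reflects_iso f T.forget

end Generators

/-! ### Colimits of coproducts with a fixed summand, and of coalgebras. -/

section Colimits
universe v w w₁ w₂
variable {C : Type w} [Category.{v} C] {J : Type w₁} [Category.{w₂} J]

/-- Adding a fixed summand preserves connected colimits. -/
theorem preservesColimitsOfShape_coprod [HasBinaryCoproducts C] [IsConnected J] (A : C) :
    PreservesColimitsOfShape J (coprod.functor.obj A) := by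
  refine ⟨fun {D} => ⟨fun {c} hc => ⟨?_⟩⟩⟩
  let ℓ : ∀ (s : Cocone (D ⋙ coprod.functor.obj A)) (j : J), A ⨿ D.obj j ⟶ s.pt :=
    fun s j => s.ι.app j
  have hℓ : ∀ s {i j : J} (f : i ⟶ j), coprod.map (𝟙 A) (D.map f) ≫ ℓ s j = ℓ s i :=
    fun s i j f => s.w f
  -- The components on the fixed summand do not vary along morphisms of `J`, so connectedness makes
  -- them all equal.
  have hconst : ∀ s (i j : J), coprod.inl ≫ ℓ s i = coprod.inl ≫ ℓ s j :=
    fun s => constant_of_preserves_morphisms (fun i => coprod.inl ≫ ℓ s i) fun i j f => by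
      simp [← hℓ s f]
  let d : ∀ s : Cocone (D ⋙ coprod.functor.obj A), c.pt ⟶ s.pt := fun s =>
    hc.desc ⟨s.pt,
      { app := fun j => coprod.inr ≫ ℓ s j
        naturality := fun i j f => by simp [← hℓ s f] }⟩
  have hd : ∀ s j, c.ι.app j ≫ d s = coprod.inr ≫ ℓ s j := fun s j => hc.fac _ j
  let j₀ : J := Classical.arbitrary J
  refine
    { desc := fun s => coprod.desc (coprod.inl ≫ ℓ s j₀) (d s)
      fac := fun s j => ?_
      uniq := fun s m hm => ?_ }
  · change coprod.map (𝟙 A) (c.ι.app j) ≫ coprod.desc (coprod.inl ≫ ℓ s j₀) (d s) = ℓ s j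
    refine (coprod.map_desc _ _ _ _).trans ?_
    rw [hd, Category.id_comp]
    apply coprod.hom_ext
    · exact (coprod.inl_desc _ _).trans (hconst s j₀ j)
    · exact coprod.inr_desc _ _
  · change A ⨿ c.pt ⟶ s.pt at m
    replace hm : ∀ j, coprod.map (𝟙 A) (c.ι.app j) ≫ m = ℓ s j := hm
    apply coprod.hom_ext
    · rw [coprod.inl_desc, ← hm j₀]
      simp
    · rw [coprod.inr_desc]
      refine hc.hom_ext fun j => ?_
      rw [hd, ← hm j]
      simp

/-- The forgetful functor of coalgebras preserves the colimits that exist in the base. -/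
theorem preservesColimit_forget_coalgebra {F : C ⥤ C} (D : J ⥤ Endofunctor.Coalgebra F)
    [HasColimit (D ⋙ Endofunctor.Coalgebra.forget F)] :
    PreservesColimit D (Endofunctor.Coalgebra.forget F) := by
  let G := D ⋙ Endofunctor.Coalgebra.forget F
  let inj : ∀ j, (D.obj j).V ⟶ colimit G := fun j => colimit.ι G j
  have hw : ∀ {i j} (f : i ⟶ j), (D.map f).f ≫ inj j = inj i := fun f => colimit.w G f
  have hext : ∀ {Z : C} {f g : colimit G ⟶ Z}, (∀ j, inj j ≫ f = inj j ≫ g) → f = g :=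
    fun h => colimit.hom_ext h
  let s : Cocone G := ⟨F.obj (colimit G),
    { app := fun j => (D.obj j).str ≫ F.map (inj j)
      naturality := fun i j f => by
        have h : (D.map f).f ≫ (D.obj j).str ≫ F.map (inj j) = (D.obj i).str ≫ F.map (inj i) := by
          rw [← Category.assoc, ← (D.map f).h, Category.assoc, ← F.map_comp, hw]
        exact h.trans (Category.comp_id _).symm }⟩
  have hs : ∀ j, inj j ≫ colimit.desc G s = (D.obj j).str ≫ F.map (inj j) :=
    fun j => colimit.ι_desc s j
  let c : Cocone D := ⟨⟨colimit G, colimit.desc G s⟩,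
    { app := fun j => ⟨inj j, (hs j).symm⟩
      naturality := fun i j f => by
        ext
        exact (hw f).trans (Category.comp_id _).symm }⟩
  let d : ∀ t : Cocone D, colimit G ⟶ t.pt.V := fun t =>
    colimit.desc G ((Endofunctor.Coalgebra.forget F).mapCocone t)
  have hd : ∀ t j, inj j ≫ d t = (t.ι.app j).f := fun t j =>
    colimit.ι_desc ((Endofunctor.Coalgebra.forget F).mapCocone t) j
  have hc : IsColimit c := by
    refine ⟨fun t => ⟨d t, hext fun j => ?_⟩, ?_, ?_⟩
    · change inj j ≫ colimit.desc G s ≫ F.map (d t) = _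
      rw [← Category.assoc, hs, Category.assoc, ← F.map_comp, hd, ← Category.assoc, hd]
      exact (t.ι.app j).h
    · intro t j
      ext
      exact hd t j
    · intro t m h
      refine Endofunctor.Coalgebra.Hom.ext (hext fun j => ?_)
      change _ = inj j ≫ d t
      rw [hd, ← h j]
      rfl
  refine preservesColimit_of_preserves_colimit_cocone hc ?_
  exact (colimit.isColimit G).ofIsoColimit (Cocone.ext (Iso.refl _) fun j => Category.comp_id _)

end Colimits
-- The construction `w □ c`: functoriality and associativity.
section Structures
universe v w
variable {C : Type w} [Category.{v} C] [HasBinaryCoproducts C] {F : C ⥤ C}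

/-- The structure of the coalgebra `w □ c`, in an arbitrary category. -/
noncomputable def squareStr {X A : C} (c : A ⟶ F.obj A) (w : X ⟶ F.obj X ⨿ A) :
    X ⨿ A ⟶ F.obj (X ⨿ A) :=
  coprod.desc w coprod.inr ≫ coprod.map (𝟙 (F.obj X)) c ≫
    coprod.desc (F.map coprod.inl) (F.map coprod.inr)

theorem inl_squareStr {X A : C} (c : A ⟶ F.obj A) (w : X ⟶ F.obj X ⨿ A) :
    coprod.inl ≫ squareStr c w = w ≫ coprod.desc (F.map coprod.inl) (c ≫ F.map coprod.inr) := by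
  rw [squareStr, coprod.inl_desc_assoc, coprod.map_desc, Category.id_comp]

theorem inr_squareStr {X A : C} (c : A ⟶ F.obj A) (w : X ⟶ F.obj X ⨿ A) :
    coprod.inr ≫ squareStr c w = c ≫ F.map coprod.inr := by
  rw [squareStr, coprod.inr_desc_assoc, coprod.inr_map_assoc, coprod.inr_desc]

theorem inl_squareStr_assoc {X A Z : C} (c : A ⟶ F.obj A) (w : X ⟶ F.obj X ⨿ A)
    (h : F.obj (X ⨿ A) ⟶ Z) : coprod.inl ≫ squareStr c w ≫ h =
      w ≫ coprod.desc (F.map coprod.inl) (c ≫ F.map coprod.inr) ≫ h := by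
  rw [← Category.assoc, inl_squareStr, Category.assoc]

theorem inr_squareStr_assoc {X A Z : C} (c : A ⟶ F.obj A) (w : X ⟶ F.obj X ⨿ A)
    (h : F.obj (X ⨿ A) ⟶ Z) :
    coprod.inr ≫ squareStr c w ≫ h = c ≫ F.map coprod.inr ≫ h := by
  rw [← Category.assoc, inr_squareStr, Category.assoc]

theorem coprodStr_desc {A B D : C} {a : A ⟶ F.obj A} {b : B ⟶ F.obj B} {d : D ⟶ F.obj D}
    {f : A ⟶ D} {g : B ⟶ D} (hf : a ≫ F.map f = f ≫ d) (hg : b ≫ F.map g = g ≫ d) :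
    coprod.desc (a ≫ F.map coprod.inl) (b ≫ F.map coprod.inr) ≫ F.map (coprod.desc f g) =
      coprod.desc f g ≫ d := by
  rw [coprod.desc_comp, Category.assoc, Category.assoc, ← F.map_comp, ← F.map_comp,
    coprod.inl_desc, coprod.inr_desc, hf, hg, coprod.desc_comp]

theorem squareStr_hom {X Y A B : C} {c : A ⟶ F.obj A} {d : B ⟶ F.obj B} {w : X ⟶ F.obj X ⨿ A}
    {v : Y ⟶ F.obj Y ⨿ B} (m : X ⟶ Y) (k : A ⟶ B) (hk : c ≫ F.map k = k ≫ d)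
    (h : w ≫ coprod.map (F.map m) k = m ≫ v) :
    squareStr c w ≫ F.map (coprod.map m k) = coprod.map m k ≫ squareStr d v := by
  apply coprod.hom_ext
  · rw [inl_squareStr_assoc, coprod.inl_map_assoc, inl_squareStr, ← reassoc_of% h,
      coprod.map_desc, coprod.desc_comp, Category.assoc, ← F.map_comp, ← F.map_comp,
      coprod.inl_map, coprod.inr_map, F.map_comp, F.map_comp, reassoc_of% hk]
  · rw [inr_squareStr_assoc, coprod.inr_map_assoc, inr_squareStr, ← F.map_comp, coprod.inr_map,
      F.map_comp, reassoc_of% hk]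

/-- The associator is a coalgebra homomorphism from `(e □ w) □ c` to `(inl • e) □ (w □ c)`, which is
the content of compositionality. -/
theorem squareStr_associator {X Y A : C} (c : A ⟶ F.obj A) (e : X ⟶ F.obj X ⨿ Y)
    (w : Y ⟶ F.obj Y ⨿ A) :
    squareStr c (coprod.desc e coprod.inr ≫ coprod.map (𝟙 (F.obj X)) w ≫
      (coprod.associator (F.obj X) (F.obj Y) A).inv ≫
      coprod.map (coprod.desc (F.map coprod.inl) (F.map coprod.inr)) (𝟙 A)) ≫
        F.map (coprod.associator X Y A).hom =
      (coprod.associator X Y A).hom ≫ squareStr (squareStr c w)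
        (e ≫ coprod.map (𝟙 (F.obj X)) (coprod.inl : Y ⟶ Y ⨿ A)) := by
  have h₁ : (coprod.inl : X ⟶ X ⨿ Y) ≫ (coprod.inl : X ⨿ Y ⟶ (X ⨿ Y) ⨿ A) ≫
      (coprod.associator X Y A).hom = coprod.inl := by
    simp only [coprod.associator_hom, coprod.inl_desc]
  have h₂ : (coprod.inr : Y ⟶ X ⨿ Y) ≫ (coprod.inl : X ⨿ Y ⟶ (X ⨿ Y) ⨿ A) ≫
      (coprod.associator X Y A).hom = coprod.inl ≫ coprod.inr := by
    simp only [coprod.associator_hom, coprod.inl_desc, coprod.inr_desc]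
  have h₃ : (coprod.inr : A ⟶ (X ⨿ Y) ⨿ A) ≫
      (coprod.associator X Y A).hom = coprod.inr ≫ coprod.inr := by
    simp only [coprod.associator_hom, coprod.inr_desc]
  have k : (coprod.associator (F.obj X) (F.obj Y) A).inv ≫
      coprod.map (coprod.desc (F.map (coprod.inl : X ⟶ X ⨿ Y)) (F.map coprod.inr)) (𝟙 A) ≫
      coprod.desc (F.map coprod.inl) (c ≫ F.map coprod.inr) ≫
      F.map (coprod.associator X Y A).hom =
      coprod.desc (F.map coprod.inl) (coprod.desc (F.map coprod.inl) (c ≫ F.map coprod.inr) ≫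
        F.map coprod.inr) := by
    apply coprod.hom_ext
    · simp only [coprod.associator_inv, coprod.inl_desc, coprod.inl_desc_assoc,
        coprod.inl_map_assoc, Category.assoc, ← F.map_comp, h₁]
    · apply coprod.hom_ext
      · simp only [coprod.associator_inv, coprod.inl_desc_assoc, coprod.inr_desc,
        coprod.inr_desc_assoc, coprod.inl_map_assoc, Category.assoc, ← F.map_comp, h₂]
      · simp only [coprod.associator_inv, coprod.inr_desc, coprod.inr_desc_assoc,
        coprod.inr_map_assoc, Category.assoc, Category.id_comp, ← F.map_comp, h₃]
  have k' : coprod.map (𝟙 (F.obj X)) w ≫ coprod.desc (F.map coprod.inl)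
      (coprod.desc (F.map coprod.inl) (c ≫ F.map coprod.inr) ≫ F.map coprod.inr) =
      coprod.desc (F.map coprod.inl) (coprod.inl ≫ squareStr c w ≫ F.map coprod.inr) := by
    rw [coprod.map_desc, Category.id_comp, inl_squareStr_assoc]
  apply coprod.hom_ext
  · rw [inl_squareStr_assoc]
    simp only [Category.assoc]
    rw [k, k']
    apply coprod.hom_ext
    · rw [coprod.inl_desc_assoc, reassoc_of% h₁, inl_squareStr, Category.assoc, coprod.map_desc,
        Category.id_comp]
    · rw [coprod.inr_desc_assoc, reassoc_of% h₂, inr_squareStr, coprod.inr_desc]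
  · rw [inr_squareStr_assoc, reassoc_of% h₃, inr_squareStr, inr_squareStr_assoc, ← F.map_comp,
      ← F.map_comp, h₃]

end Structures

/-! ### The ffg-coalgebras form a sifted category. -/

section CoalgebraHoms
variable {S : Type u} {T : CategoryTheory.Monad (S → Type u)} {F : T.Algebra ⥤ T.Algebra}

/-- The colimit injections are compatible with coalgebra homomorphisms. -/
theorem comp_phiIn {c d : FFGCoalgebra F} (m : c.obj.V ⟶ d.obj.V)
    (hm : c.obj.str ≫ F.map m = m ≫ d.obj.str) : m ≫ phiIn F d = phiIn F c :=
  congrArg Endofunctor.Coalgebra.Hom.f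
    (colimit.w (ffgInclusion F) (ObjectProperty.homMk ⟨m, hm⟩ : c ⟶ d))

theorem phiIn_str (c : FFGCoalgebra F) :
    phiIn F c ≫ (phi F).str = c.obj.str ≫ F.map (phiIn F c) :=
  (colimit.ι (ffgInclusion F) c).h.symm

/-- The coproduct of two ffg-coalgebras. -/
noncomputable def coprodCoalgebra (c d : FFGCoalgebra F) : FFGCoalgebra F where
  obj :=
    { V := c.obj.V ⨿ d.obj.V
      str := coprod.desc (c.obj.str ≫ F.map coprod.inl) (d.obj.str ≫ F.map coprod.inr) }
  property := isFFG_coprod T c.property d.property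

instance hasBinaryCoproducts_ffgCoalgebra : HasBinaryCoproducts (FFGCoalgebra F) := by
  have (c d : FFGCoalgebra F) : HasColimit (pair c d) := by
    let i₁ : c ⟶ coprodCoalgebra c d :=
      ObjectProperty.homMk ⟨(coprod.inl : c.obj.V ⟶ c.obj.V ⨿ d.obj.V),
        (coprod.inl_desc _ _).symm⟩
    let i₂ : d ⟶ coprodCoalgebra c d :=
      ObjectProperty.homMk ⟨(coprod.inr : d.obj.V ⟶ c.obj.V ⨿ d.obj.V),
        (coprod.inr_desc _ _).symm⟩
    refine ⟨⟨BinaryCofan.mk i₁ i₂, BinaryCofan.IsColimit.mk _ (fun {t} f g =>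
      ObjectProperty.homMk ⟨coprod.desc f.hom.f g.hom.f, ?_⟩) ?_ ?_ ?_⟩⟩
    · exact coprodStr_desc f.hom.h g.hom.h
    · intro t f g
      ext : 2
      exact coprod.inl_desc _ _
    · intro t f g
      ext : 2
      exact coprod.inr_desc _ _
    · intro t f g m h₁ h₂
      ext : 2
      apply coprod.hom_ext
      · refine Eq.trans ?_ (coprod.inl_desc _ _).symm
        rw [← h₁]
        rfl
      · refine Eq.trans ?_ (coprod.inr_desc _ _).symm
        rw [← h₂]
        rfl
  exact hasBinaryCoproducts_of_hasColimit_pair _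

/-- The free algebra on the empty sorted set is initial, so it carries a coalgebra structure. -/
instance nonempty_ffgCoalgebra : Nonempty (FFGCoalgebra F) := by
  have : T.free.IsLeftAdjoint := T.adj.isLeftAdjoint
  have h : IsInitial (T.free.obj fun _ => PEmpty.{u + 1}) :=
    IsInitial.isInitialObj T.free _ (IsInitial.ofUniqueHom
      (fun A s => TypeCat.ofHom fun x => x.elim) fun A m => by
        funext s
        ext x
        exact x.elim)
  have : Finite (Σ _ : S, PEmpty.{u + 1}) := Finite.of_injective (fun x => x.2) fun x => x.2.elim
  exact ⟨⟨⟨_, h.to _⟩, isFFG_free _⟩⟩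

instance hasColimitsOfShape_ffgCoalgebra : HasColimitsOfShape (FFGCoalgebra F) (Type u) :=
  hasColimitsOfShape_of_equivalence (equivSmallModel.{u} (FFGCoalgebra F)).symm

instance hasColimitsOfShape_ffgCoalgebra_algebra :
    HasColimitsOfShape (FFGCoalgebra F) T.Algebra :=
  hasColimitsOfShape_of_equivalence (equivSmallModel.{u} (FFGCoalgebra F)).symm

/-- The hypothesis speaks of small index categories, so it is applied to a small model of the
ffg-coalgebras. -/
theorem PreservesSiftedColimits.preservesColimitsOfShape (hF : PreservesSiftedColimits F) :
    PreservesColimitsOfShape (FFGCoalgebra F) F := by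
  have : IsSifted (SmallModel.{u} (FFGCoalgebra F)) :=
    IsSifted.isSifted_of_equiv (equivSmallModel.{u} (FFGCoalgebra F)).symm
  have := hF (SmallModel.{u} (FFGCoalgebra F))
  exact preservesColimitsOfShape_of_equiv (equivSmallModel.{u} (FFGCoalgebra F)).symm F

/-- A coalgebra homomorphism between equations extends to the associated coalgebras. -/
theorem squareCoalgebra_hom {X Y : T.Algebra} (hX : IsFFG T X) (hY : IsFFG T Y)
    {c d : FFGCoalgebra F} {w : X ⟶ F.obj X ⨿ c.obj.V} {v : Y ⟶ F.obj Y ⨿ d.obj.V}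
    (m : X ⟶ Y) (k : c.obj.V ⟶ d.obj.V) (hk : c.obj.str ≫ F.map k = k ≫ d.obj.str)
    (h : w ≫ coprod.map (F.map m) k = m ≫ v) :
    (squareCoalgebra hX c w).obj.str ≫ F.map (coprod.map m k) =
      coprod.map m k ≫ (squareCoalgebra hY d v).obj.str :=
  squareStr_hom m k hk h

theorem coprod_inr_phiIn_squareCoalgebra {X : T.Algebra} (hX : IsFFG T X) (c : FFGCoalgebra F)
    (w : X ⟶ F.obj X ⨿ c.obj.V) :
    (coprod.inr : c.obj.V ⟶ X ⨿ c.obj.V) ≫ phiIn F (squareCoalgebra hX c w) = phiIn F c :=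
  comp_phiIn (d := squareCoalgebra hX c w) coprod.inr
    (inr_squareStr c.obj.str w).symm

theorem squareCoalgebra_assoc_hom {X Y : T.Algebra} (hX : IsFFG T X) (hY : IsFFG T Y)
    (c : FFGCoalgebra F) (e : X ⟶ F.obj X ⨿ Y) (w : Y ⟶ F.obj Y ⨿ c.obj.V) :
    (squareCoalgebra (isFFG_coprod T hX hY) c (square e w)).obj.str ≫
        F.map (coprod.associator X Y c.obj.V).hom =
      (coprod.associator X Y c.obj.V).hom ≫ (squareCoalgebra hX (squareCoalgebra hY c w)
        (bullet (coprod.inl : Y ⟶ Y ⨿ c.obj.V) e)).obj.str :=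
  squareStr_associator c.obj.str e w

end CoalgebraHoms
-- Morphisms into `φF` obtained from coalgebras on `X + C`.
section Injections
variable {S : Type u} {T : CategoryTheory.Monad (S → Type u)} {F : T.Algebra ⥤ T.Algebra}

/-- The coalgebra on `X + C` given by a morphism `X ⟶ FC` into an ffg-coalgebra. -/
noncomputable def extendCoalgebra {X : T.Algebra} (hX : IsFFG T X) (c : FFGCoalgebra F)
    (f : X ⟶ F.obj c.obj.V) : FFGCoalgebra F where
  obj :=
    { V := X ⨿ c.obj.V
      str := coprod.desc f c.obj.str ≫ F.map coprod.inr }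
  property := isFFG_coprod T hX c.property

/-- This is the candidate preimage of `F(in c) ∘ f` under the structure of `φF`. -/
noncomputable def extendIn {X : T.Algebra} (hX : IsFFG T X) (c : FFGCoalgebra F)
    (f : X ⟶ F.obj c.obj.V) : X ⟶ (phi F).V :=
  (coprod.inl : X ⟶ X ⨿ c.obj.V) ≫ phiIn F (extendCoalgebra hX c f)

theorem extendIn_str {X : T.Algebra} (hX : IsFFG T X) (c : FFGCoalgebra F)
    (f : X ⟶ F.obj c.obj.V) : extendIn hX c f ≫ (phi F).str = f ≫ F.map (phiIn F c) := by
  have h : (coprod.inr : c.obj.V ⟶ X ⨿ c.obj.V) ≫ phiIn F (extendCoalgebra hX c f) = phiIn F c :=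
    comp_phiIn (d := extendCoalgebra hX c f) coprod.inr (coprod.inr_desc_assoc _ _ _).symm
  refine (Category.assoc _ _ _).trans
    ((congrArg (coprod.inl ≫ ·) (phiIn_str (extendCoalgebra hX c f))).trans ?_)
  rw [← h]
  refine Eq.trans ?_ (congrArg (f ≫ ·) (F.map_comp _ _)).symm
  refine (congrArg (coprod.inl ≫ ·) (Category.assoc _ _ _)).trans ?_
  exact coprod.inl_desc_assoc _ _ _

theorem extendIn_comp {X : T.Algebra} (hX : IsFFG T X) {c d : FFGCoalgebra F}
    (m : c.obj.V ⟶ d.obj.V) (hm : c.obj.str ≫ F.map m = m ≫ d.obj.str) (f : X ⟶ F.obj c.obj.V) :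
    extendIn hX d (f ≫ F.map m) = extendIn hX c f := by
  have h : coprod.map (𝟙 X) m ≫ phiIn F (extendCoalgebra hX d (f ≫ F.map m)) =
      phiIn F (extendCoalgebra hX c f) := by
    refine comp_phiIn (c := extendCoalgebra hX c f) (d := extendCoalgebra hX d (f ≫ F.map m))
      (coprod.map (𝟙 X) m) ?_
    change (coprod.desc f c.obj.str ≫ F.map coprod.inr) ≫ F.map (coprod.map (𝟙 X) m) =
      coprod.map (𝟙 X) m ≫ coprod.desc (f ≫ F.map m) d.obj.str ≫ F.map coprod.inr
    rw [Category.assoc, ← F.map_comp, coprod.inr_map, F.map_comp, coprod.map_desc_assoc,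
      Category.id_comp, ← hm, ← coprod.desc_comp, Category.assoc]
  rw [extendIn, extendIn, ← h]
  exact ((coprod.inl_map_assoc _ _ _).trans (Category.id_comp _)).symm

/-- The copairing `[u, id]` is a coalgebra homomorphism from the extended coalgebra to `c`. This
gives the injectivity half of `isIso_phi_str`. -/
theorem extendIn_comp_str {X : T.Algebra} (hX : IsFFG T X) (c : FFGCoalgebra F)
    (u : X ⟶ c.obj.V) : extendIn hX c (u ≫ c.obj.str) = u ≫ phiIn F c := by
  have h : coprod.desc u (𝟙 c.obj.V) ≫ phiIn F c =
      phiIn F (extendCoalgebra hX c (u ≫ c.obj.str)) := by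
    refine comp_phiIn (c := extendCoalgebra hX c (u ≫ c.obj.str)) (coprod.desc u (𝟙 c.obj.V)) ?_
    change (coprod.desc (u ≫ c.obj.str) c.obj.str ≫ F.map coprod.inr) ≫ F.map _ = _
    rw [Category.assoc, ← F.map_comp, coprod.inr_desc, F.map_id, Category.comp_id]
    exact ((coprod.desc_comp _ _ _).trans (by rw [Category.id_comp])).symm
  rw [extendIn, ← h]
  exact coprod.inl_desc_assoc _ _ _

/-- The candidate solution `in(w □ c) ∘ inl`. -/
noncomputable def squareIn {X : T.Algebra} (hX : IsFFG T X) (c : FFGCoalgebra F)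
    (w : X ⟶ F.obj X ⨿ c.obj.V) : X ⟶ (phi F).V :=
  coprod.inl ≫ phiIn F (squareCoalgebra hX c w)

theorem squareIn_comp {X Y : T.Algebra} (hX : IsFFG T X) (hY : IsFFG T Y)
    {c d : FFGCoalgebra F} {w : X ⟶ F.obj X ⨿ c.obj.V} {v : Y ⟶ F.obj Y ⨿ d.obj.V}
    (m : X ⟶ Y) (k : c.obj.V ⟶ d.obj.V) (hk : c.obj.str ≫ F.map k = k ≫ d.obj.str)
    (h : w ≫ coprod.map (F.map m) k = m ≫ v) :
    m ≫ squareIn hY d v = squareIn hX c w := by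
  have := comp_phiIn (c := squareCoalgebra hX c w) (d := squareCoalgebra hY d v)
    (coprod.map m k) (squareCoalgebra_hom hX hY m k hk h)
  rw [squareIn, squareIn, ← this]
  exact (coprod.inl_map_assoc _ _ _).symm

/-- This is the solution equation composed with the structure of `φF`, before that structure is
inverted. -/
theorem squareIn_str {X : T.Algebra} (hX : IsFFG T X) (c : FFGCoalgebra F)
    (w : X ⟶ F.obj X ⨿ c.obj.V) : squareIn hX c w ≫ (phi F).str =
      w ≫ coprod.desc (F.map (squareIn hX c w)) (c.obj.str ≫ F.map (phiIn F c)) := by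
  refine (Category.assoc _ _ _).trans
    ((congrArg (coprod.inl ≫ ·) (phiIn_str (squareCoalgebra hX c w))).trans ?_)
  refine (inl_squareStr_assoc c.obj.str w _).trans (congrArg (w ≫ ·) ?_)
  rw [← coprod_inr_phiIn_squareCoalgebra hX c w, squareIn]
  refine (coprod.desc_comp _ _ _).trans ?_
  congr 1
  · exact (F.map_comp _ _).symm
  · exact (Category.assoc _ _ _).trans (congrArg (c.obj.str ≫ ·) (F.map_comp _ _).symm)

end Injections

/-! ### The fixed point `φF` and its ffg-Elgot structure. -/

section Phi
variable {S : Type u} {T : CategoryTheory.Monad (S → Type u)}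
  [PreservesFilteredColimits T.toFunctor] {F : T.Algebra ⥤ T.Algebra}

variable (F) in
/-- The carrier of `φF` as a cocone over the carriers of the ffg-coalgebras. -/
noncomputable def phiCocone : Cocone (ffgInclusion F ⋙ Endofunctor.Coalgebra.forget F) :=
  (Endofunctor.Coalgebra.forget F).mapCocone (colimit.cocone (ffgInclusion F))

variable (F) in
noncomputable def isColimitPhiCocone : IsColimit (phiCocone F) :=
  have := preservesColimit_forget_coalgebra (ffgInclusion F)
  isColimitOfPreserves _ (colimit.isColimit _)

/-- The cocone of morphisms from `X` into the values of a functor at `φF`. -/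
noncomputable def phiHomCocone (X : T.Algebra) (G : T.Algebra ⥤ T.Algebra) :
    Cocone (((ffgInclusion F ⋙ Endofunctor.Coalgebra.forget F) ⋙ G) ⋙
      coyoneda.obj (Opposite.op X)) :=
  (coyoneda.obj (Opposite.op X)).mapCocone (G.mapCocone (phiCocone F))

noncomputable def isColimitPhiHomCocone {X : T.Algebra} (hX : IsFFG T X)
    (G : T.Algebra ⥤ T.Algebra) [PreservesColimitsOfShape (FFGCoalgebra F) G] :
    IsColimit (phiHomCocone (F := F) X G) :=
  have := preservesColimitsOfShape_coyoneda T (FFGCoalgebra F) hX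
  isColimitOfPreserves _ (isColimitOfPreserves _ (isColimitPhiCocone F))

theorem exists_factorization {X : T.Algebra} (hX : IsFFG T X)
    (G : T.Algebra ⥤ T.Algebra) [PreservesColimitsOfShape (FFGCoalgebra F) G]
    (e : X ⟶ G.obj (phi F).V) :
    ∃ (c : FFGCoalgebra F) (w : X ⟶ G.obj c.obj.V), w ≫ G.map (phiIn F c) = e :=
  Types.jointly_surjective_of_isColimit (isColimitPhiHomCocone hX G) e

/-- An assignment that is invariant under coalgebra homomorphisms depends only on the composite
with the colimit injection. -/
theorem factorization_respects {X : T.Algebra} (hX : IsFFG T X)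
    (G : T.Algebra ⥤ T.Algebra) [PreservesColimitsOfShape (FFGCoalgebra F) G] {α : Type u}
    (φ : ∀ c : FFGCoalgebra F, (X ⟶ G.obj c.obj.V) → α)
    (hφ : ∀ (c d : FFGCoalgebra F) (m : c.obj.V ⟶ d.obj.V)
      (_ : c.obj.str ≫ F.map m = m ≫ d.obj.str) (w : X ⟶ G.obj c.obj.V),
      φ d (w ≫ G.map m) = φ c w)
    {c d : FFGCoalgebra F} {w : X ⟶ G.obj c.obj.V} {v : X ⟶ G.obj d.obj.V}
    (h : w ≫ G.map (phiIn F c) = v ≫ G.map (phiIn F d)) : φ c w = φ d v :=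
  respects_of_isColimit (isColimitPhiHomCocone hX G)
    { pt := α
      ι :=
        { app := fun c => TypeCat.ofHom (φ c)
          naturality := fun c d m => by
            ext w
            exact hφ c d m.hom.f m.hom.h w } } h

/-- `φF` is a fixed point of `F`. -/
theorem isIso_phi_str (hF : PreservesSiftedColimits F) : IsIso (phi F).str := by
  have := hF.preservesColimitsOfShape
  refine isIso_of_bijective_comp _ fun X hX => ⟨fun a b hab => ?_, fun g => ?_⟩
  · obtain ⟨c, u, rfl⟩ := exists_factorization hX (𝟭 _) a
    obtain ⟨d, v, rfl⟩ := exists_factorization hX (𝟭 _) b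
    change X ⟶ c.obj.V at u
    change X ⟶ d.obj.V at v
    change u ≫ phiIn F c = v ≫ phiIn F d
    replace hab : (u ≫ phiIn F c) ≫ (phi F).str = (v ≫ phiIn F d) ≫ (phi F).str := hab
    rw [Category.assoc, Category.assoc, phiIn_str, phiIn_str, ← Category.assoc,
      ← Category.assoc] at hab
    -- Both sides become values of `extendIn`, which depends only on the composite into `F(φF)`.
    rw [← extendIn_comp_str hX, ← extendIn_comp_str hX]
    exact factorization_respects hX F (extendIn hX)
      (fun c d m hm w => extendIn_comp hX m hm w) hab
  · obtain ⟨c, f, rfl⟩ := exists_factorization hX F g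
    exact ⟨extendIn hX c f, extendIn_str hX c f⟩

theorem exists_eq_bullet {X : T.Algebra} (hX : IsFFG T X) (e : X ⟶ F.obj X ⨿ (phi F).V) :
    ∃ (c : FFGCoalgebra F) (w : X ⟶ F.obj X ⨿ c.obj.V), e = bullet (phiIn F c) w := by
  have := preservesColimitsOfShape_coprod (J := FFGCoalgebra F) (F.obj X)
  obtain ⟨c, w, h⟩ := exists_factorization hX (coprod.functor.obj (F.obj X)) e
  exact ⟨c, w, h.symm⟩

theorem squareIn_eq_of_bullet_eq {X : T.Algebra} (hX : IsFFG T X) {c d : FFGCoalgebra F}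
    {w : X ⟶ F.obj X ⨿ c.obj.V} {v : X ⟶ F.obj X ⨿ d.obj.V}
    (h : bullet (phiIn F c) w = bullet (phiIn F d) v) : squareIn hX c w = squareIn hX d v := by
  have := preservesColimitsOfShape_coprod (J := FFGCoalgebra F) (F.obj X)
  refine factorization_respects hX (coprod.functor.obj (F.obj X)) (squareIn hX) ?_ h
  intro c d m hm w
  change squareIn hX d (w ≫ coprod.map (𝟙 (F.obj X)) m) = _
  exact (Category.id_comp _).symm.trans
    (squareIn_comp hX hX (𝟙 X) m hm (by
      rw [F.map_id, Category.id_comp]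
      rfl))

variable (F) in
/-- The operation assigning to `e = in c • w` the morphism `in(w □ c) ∘ inl`. -/
noncomputable def phiDagger : SolutionOperator F (phi F).V := fun _ hX e =>
  squareIn hX (exists_eq_bullet hX e).choose (exists_eq_bullet hX e).choose_spec.choose

theorem phiDagger_bullet {X : T.Algebra} (hX : IsFFG T X) (c : FFGCoalgebra F)
    (w : X ⟶ F.obj X ⨿ c.obj.V) :
    phiDagger F X hX (bullet (phiIn F c) w) = squareIn hX c w :=
  squareIn_eq_of_bullet_eq hX
    (exists_eq_bullet hX (bullet (phiIn F c) w)).choose_spec.choose_spec.symm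

theorem isFFGElgotAlgebra_phiDagger [IsIso (phi F).str] :
    IsFFGElgotAlgebra ⟨(phi F).V, inv (phi F).str⟩ (phiDagger F) where
  solution X hX e := by
    obtain ⟨c, w, rfl⟩ := exists_eq_bullet hX e
    change phiDagger F X hX _ = bullet (phiIn F c) w ≫
      coprod.map (F.map (phiDagger F X hX _)) (𝟙 (phi F).V) ≫
        coprod.desc (inv (phi F).str) (𝟙 (phi F).V)
    rw [phiDagger_bullet, ← cancel_mono (phi F).str, squareIn_str, bullet]
    simp only [Category.assoc, coprod.map_desc, coprod.desc_comp, Category.id_comp,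
      IsIso.inv_hom_id, Category.comp_id, phiIn_str]
  weakFunctoriality X Y Z hX hY hZ e f m hm h := by
    -- As `Z` is ffg, one coalgebra `c` serves as the parameter object for both equations.
    obtain ⟨c, k, rfl⟩ := exists_factorization hZ (𝟭 _) h
    change Z ⟶ c.obj.V at k
    have hb : ∀ {W : T.Algebra} (g : W ⟶ F.obj W ⨿ Z),
        bullet (k ≫ phiIn F c) g = bullet (phiIn F c) (bullet k g) := by
      intro W g
      rw [bullet, bullet, bullet, Category.assoc, coprod.map_map, Category.id_comp]
    change m ≫ phiDagger F Y hY (bullet (k ≫ phiIn F c) f) =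
      phiDagger F X hX (bullet (k ≫ phiIn F c) e)
    rw [hb, hb, phiDagger_bullet, phiDagger_bullet]
    refine squareIn_comp hX hY m (𝟙 _) (by rw [F.map_id, Category.comp_id, Category.id_comp]) ?_
    rw [bullet, bullet, ← reassoc_of% hm]
    simp only [Category.assoc, coprod.map_map, Category.id_comp, Category.comp_id]
  compositionality X Y hX hY e f := by
    obtain ⟨c, w, rfl⟩ := exists_eq_bullet hY f
    have h₁ : bullet (squareIn hY c w) e =
        bullet (phiIn F (squareCoalgebra hY c w)) (bullet (coprod.inl : Y ⟶ Y ⨿ c.obj.V) e) := by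
      exact (congrArg (e ≫ ·) ((coprod.map_map _ _ _ _).trans
        (by
          rw [Category.id_comp]
          rfl))).symm.trans (Category.assoc _ _ _).symm
    have h₂ : square e (bullet (phiIn F c) w) = bullet (phiIn F c) (square e w) := by
      -- `square` uses the inverse associator, so naturality is first transposed to the inverse.
      have h := coprod.associator_naturality (𝟙 (F.obj X)) (𝟙 (F.obj Y)) (phiIn F c)
      rw [coprod.map_id_id, ← Iso.eq_comp_inv, Category.assoc, ← Iso.inv_comp_eq] at h
      unfold square bullet
      have k : coprod.map (𝟙 (F.obj X)) (w ≫ coprod.map (𝟙 (F.obj Y)) (phiIn F c)) =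
          coprod.map (𝟙 (F.obj X)) w ≫
            coprod.map (𝟙 (F.obj X)) (coprod.map (𝟙 (F.obj Y)) (phiIn F c)) := by
        rw [coprod.map_map, Category.id_comp]
      rw [k, Category.assoc, ← reassoc_of% h]
      simp only [Category.assoc, coprod.map_map, Category.id_comp, Category.comp_id]
    rw [phiDagger_bullet, h₂, phiDagger_bullet, h₁, phiDagger_bullet]
    have := comp_phiIn (c := squareCoalgebra (isFFG_coprod T hX hY) c (square e w))
      (d := squareCoalgebra hX (squareCoalgebra hY c w)
        (bullet (coprod.inl : Y ⟶ Y ⨿ c.obj.V) e))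
      (coprod.associator X Y c.obj.V).hom (squareCoalgebra_assoc_hom hX hY c e w)
    rw [squareIn, squareIn, ← this]
    refine Eq.symm (Eq.trans (Category.assoc _ _ _).symm ((Category.assoc _ _ _).symm.trans
      (congrArg (· ≫ _) ?_)))
    have h : (coprod.inl : X ⟶ X ⨿ Y) ≫ (coprod.inl : X ⨿ Y ⟶ (X ⨿ Y) ⨿ c.obj.V) ≫
        (coprod.associator X Y c.obj.V).hom = coprod.inl := by
      simp only [coprod.associator_hom, coprod.inl_desc]
    exact (Category.assoc _ _ _).trans h

end Phi
end FFG

theorem mainTheorem8 {S : Type u} (T : CategoryTheory.Monad (S → Type u))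
    [PreservesFilteredColimits T.toFunctor] (F : T.Algebra ⥤ T.Algebra)
    (hF : FFG.PreservesSiftedColimits F) :
    ∃ (_ : IsIso (FFG.phi F).str) (dag : FFG.SolutionOperator F (FFG.phi F).V),
      (∀ (X : T.Algebra) (_ : FFG.IsFFG T X) (e : X ⟶ F.obj X ⨿ (FFG.phi F).V),
        ∃ (c : FFG.FFGCoalgebra F) (w : X ⟶ F.obj X ⨿ c.obj.V),
          e = FFG.bullet (FFG.phiIn F c) w) ∧
      (∀ (X : T.Algebra) (hX : FFG.IsFFG T X) (e : X ⟶ F.obj X ⨿ (FFG.phi F).V)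
        (c : FFG.FFGCoalgebra F) (w : X ⟶ F.obj X ⨿ c.obj.V),
        e = FFG.bullet (FFG.phiIn F c) w →
          dag X hX e = coprod.inl ≫ FFG.phiIn F (FFG.squareCoalgebra hX c w)) ∧
      FFG.IsFFGElgotAlgebra ⟨(FFG.phi F).V, inv (FFG.phi F).str⟩ dag := by
  have hiso := FFG.isIso_phi_str hF
  refine ⟨hiso, FFG.phiDagger F, fun X hX e => FFG.exists_eq_bullet hX e, ?_,
    FFG.isFFGElgotAlgebra_phiDagger⟩
  rintro X hX _ c w rfl
  exact FFG.phiDagger_bullet hX c w
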